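/- Let $L>0$, $\nu>0$, and let $\Omega=\mathbb T_L\times(-\tfrac12,\tfrac12)$, where $\mathbb T_L$ is the circle of length $L$; write $\langle f\rangle=\frac1{|\Omega|}\int_\Omega f\,dx$ and $e_1=(1,0)$. Let $V$ be the space of divergence-free vector fields in $H^1_0(\Omega;\mathbb R^2)$, where $H^1_0(\Omega)$ is the closure of $C_c^\infty(\Omega)$ in $H^1(\Omega)$ (zero values at the walls $x_2=\pm\frac12$, periodicity in $x_1$). Let $U\in L^\infty(\Omega;\mathbb R^2)$ satisfy $\nabla\cdot U=0$ in the sense of distributions in $\Omega$. A weak solution of the steady problem $$\nabla\cdot u=0,\qquad U\cdot\nabla u=-\nabla p+\nu\Delta u\ \text{ in }\Omega,\qquad u=\pm\tfrac12 e_1\ \text{ at }x_2=\pm\tfrac12,$$ is a divergence-free $u\in H^1(\Omega;\mathbb R^2)$ with $u-x_2e_1\in H^1_0(\Omega;\mathbb R^2)$ and $\int_\Omega (U\cdot\nabla u)\cdot\varphi\,dx=-\nu\int_\Omega\nabla u:\nabla\varphi\,dx$ for all $\varphi\in V$. Let $\mathbb P$ be the Leray projector, that is, the orthogonal projection of $L^2(\Omega;\mathbb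 R^2)$ onto the divergence-free fields with zero normal component at the walls. Let $\Delta^{-1}$ be the inverse of the Laplacian on divergence-free fields with homogeneous boundary conditions (the inverse Stokes operator): $w=\Delta^{-1}g$ is the element of $V$ with $-\int_\Omega\nabla w:\nabla\varphi\,dx=\int_\Omega g\cdot\varphi\,dx$ for all $\varphi\in V$. Then for every $g\in L^2(\Omega;\mathbb R^2)$ the field $\Delta^{-1}g$ exists and is unique, the steady problem has exactly one weak solution $u$ (uniqueness up to null sets in both cases), and $$\nu\langle|\nabla u|^2\rangle-\nu=\max_{\tilde v\in V}\Big(-2\langle U_2\tilde v_1\rangle-\nu\langle|\nabla\tilde v|^2\rangle-\frac1\nu\big\langle|\nabla\Delta^{-1}\mathbb P(U\cdot\nabla\tilde v)|^2\big\rangle\Big),$$ the maximum being attained. -/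

import Mathlib

open MeasureTheory Set Filter Topology
open scoped ContDiff ENNReal

noncomputable section

namespace Couette

/-- The periodic channel: the points `(x₁, x₂)` with `x₁` in the circle of length `L`. The walls
`x₂ = ±1/2` enter through the measure `vol L` and through the supports of the test functions. -/
abbrev Channel (L : ℝ) : Type := AddCircle L × ℝ

/-- Lebesgue measure on `Ω = 𝕋_L × (-1/2, 1/2)`. -/
def vol (L : ℝ) [Fact (0 < L)] : Measure (Channel L) :=
  (volume : Measure (AddCircle L)).prod
    ((volume : Measure ℝ).restrict (Ioo (-(1 / 2) : ℝ) (1 / 2)))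

/-- Smoothness, expressed through the lift to `ℝ × ℝ` that is `L`-periodic in `x₁`. -/
def IsSmooth {L : ℝ} (φ : Channel L → ℝ) : Prop :=
  ContDiff ℝ ∞ (fun p : ℝ × ℝ => φ ((p.1 : AddCircle L), p.2))

/-- `φ ∈ C_c^∞(Ω)`: smooth, and zero near the walls. -/
def IsTest {L : ℝ} (φ : Channel L → ℝ) : Prop :=
  IsSmooth φ ∧ ∃ a b : ℝ, -(1 / 2) < a ∧ b < 1 / 2 ∧ ∀ x : Channel L, φ x ≠ 0 → x.2 ∈ Icc a b

/-- Classical partial derivatives; the index `0` stands for `x₁` and the index `1` for `x₂`. -/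
def pd {L : ℝ} (j : Fin 2) (φ : Channel L → ℝ) (x : Channel L) : ℝ :=
  if j = 0 then deriv (fun t : ℝ => φ (x.1 + (t : AddCircle L), x.2)) 0
  else deriv (fun t : ℝ => φ (x.1, t)) x.2

section Fields

variable {L : ℝ} [Fact (0 < L)]

/-- `f ∈ L²(Ω)`. -/
def MemL2 (f : Channel L → ℝ) : Prop := MemLp f 2 (vol L)

/-- `g` is the weak derivative `∂ⱼ f` in `Ω`. -/
def IsWeakDeriv (j : Fin 2) (f g : Channel L → ℝ) : Prop :=
  ∀ φ : Channel L → ℝ, IsTest φ → ∫ x, f x * pd j φ x ∂(vol L) = -∫ x, g x * φ x ∂(vol L)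

/-- `f ∈ H¹(Ω)`. -/
def MemH1 (f : Channel L → ℝ) : Prop :=
  MemL2 f ∧ ∀ j : Fin 2, ∃ g, MemL2 g ∧ IsWeakDeriv j f g

open Classical in
/-- The weak derivative `∂ⱼ f ∈ L²(Ω)`, which is determined up to null sets
(zero if there is none). -/
def wd (j : Fin 2) (f : Channel L → ℝ) : Channel L → ℝ :=
  if h : ∃ g, MemL2 g ∧ IsWeakDeriv j f g then h.choose else 0

/-- `f ∈ H¹₀(Ω)`: the closure of `C_c^∞(Ω)` in `H¹(Ω)`. -/
def MemH10 (f : Channel L → ℝ) : Prop :=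
  MemH1 f ∧ ∃ φ : ℕ → Channel L → ℝ, (∀ n, IsTest (φ n)) ∧
    Tendsto (fun n => eLpNorm (φ n - f) 2 (vol L)) atTop (𝓝 0) ∧
    ∀ j : Fin 2, Tendsto (fun n => eLpNorm (pd j (φ n) - wd j f) 2 (vol L)) atTop (𝓝 0)

/-- The divergence-free vector fields in `H¹₀(Ω)`. A vector field is the family of its two
components, `v 0` along `x₁` and `v 1` along `x₂`. -/
def H10Sigma (L : ℝ) [Fact (0 < L)] : Set (Fin 2 → Channel L → ℝ) :=
  {v | (∀ i, MemH10 (v i)) ∧ ∀ᵐ x ∂(vol L), ∑ i, wd i (v i) x = 0}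

/-- `U` is divergence-free in the sense of distributions. -/
def WeaklyDivFree (U : Fin 2 → Channel L → ℝ) : Prop :=
  ∀ φ : Channel L → ℝ, IsTest φ → ∫ x, ∑ j, U j x * pd j φ x ∂(vol L) = 0

/-- The advection term `U · ∇v`. -/
def advect (U v : Fin 2 → Channel L → ℝ) : Fin 2 → Channel L → ℝ :=
  fun i x => ∑ j, U j x * wd j (v i) x

/-- The pointwise scalar product `f · g`. -/
def dot (f g : Fin 2 → Channel L → ℝ) (x : Channel L) : ℝ := ∑ i, f i x * g i x

/-- The pointwise scalar product `∇v : ∇w`. -/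
def gradDot (v w : Fin 2 → Channel L → ℝ) (x : Channel L) : ℝ :=
  ∑ i, ∑ j, wd j (v i) x * wd j (w i) x

/-- `⟨|∇v|²⟩`, the average over `Ω`. -/
def meanGradSq (v : Fin 2 → Channel L → ℝ) : ℝ := ⨍ x, gradDot v v x ∂(vol L)

/-- The linear shear flow `x₂ e₁`, equal to `±e₁/2` at the walls `x₂ = ±1/2`. -/
def shear : Fin 2 → Channel L → ℝ := ![fun x => x.2, fun _ => 0]

/-- Weak solutions `u ∈ H¹(Ω)` of `∇·u = 0`, `U·∇u = -∇p + νΔu` with `u = ±e₁/2` at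
`x₂ = ±1/2`. The equation is tested with divergence-free fields, which removes the pressure, and
the boundary condition is `u - x₂ e₁ ∈ H¹₀(Ω)`. -/
structure IsSteadySolution (ν : ℝ) (U u : Fin 2 → Channel L → ℝ) : Prop where
  memH1 : ∀ i, MemH1 (u i)
  div_free : ∀ᵐ x ∂(vol L), ∑ i, wd i (u i) x = 0
  boundary : ∀ i, MemH10 (u i - shear i)
  momentum : ∀ φ ∈ H10Sigma L,
    ∫ x, dot (advect U u) φ x ∂(vol L) = -(ν * ∫ x, gradDot u φ x ∂(vol L))

/-- The Hilbert space `L²(Ω; ℝ²)`. -/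
abbrev L2Vec (L : ℝ) [Fact (0 < L)] : Type := PiLp 2 (fun _ : Fin 2 => Lp ℝ 2 (vol L))

/-- Gradients of functions that are smooth up to the walls. -/
def gradients (L : ℝ) [Fact (0 < L)] : Submodule ℝ (L2Vec L) :=
  Submodule.span ℝ {G | ∃ q : Channel L → ℝ, IsSmooth q ∧
    ∀ i, (G i : Channel L → ℝ) =ᵐ[vol L] pd i q}

/-- `L²_σ(Ω)`: the divergence-free fields in `L²(Ω; ℝ²)` with zero normal component at the walls,
that is, the orthogonal complement of the gradients. -/
def L2Sigma (L : ℝ) [Fact (0 < L)] : Submodule ℝ (L2Vec L) := Submodule.orthogonal (gradients L)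

instance : CompleteSpace (L2Sigma L) :=
  (Submodule.isClosed_orthogonal (gradients L)).completeSpace_coe

instance : (L2Sigma L).HasOrthogonalProjection :=
  Submodule.HasOrthogonalProjection.ofCompleteSpace (L2Sigma L)

open Classical in
/-- The Leray projector `ℙ`: the orthogonal projection of `L²(Ω; ℝ²)` onto `L²_σ(Ω)`
(zero if `f` is not in `L²`). -/
def leray (f : Fin 2 → Channel L → ℝ) : Fin 2 → Channel L → ℝ :=
  if hf : ∀ i, MemLp (f i) 2 (vol L) then
    fun i => (((L2Sigma L).starProjection
      (WithLp.toLp 2 fun i => (hf i).toLp (f i)) : L2Vec L) i : Channel L → ℝ)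
  else 0

/-- `w = Δ⁻¹ g`, where `Δ` is the Laplacian on divergence-free fields with zero boundary values, in
weak form: `w` is the divergence-free field in `H¹₀(Ω)` with `Δw = g + ∇q` for some pressure `q`. -/
def IsInvLaplace (g w : Fin 2 → Channel L → ℝ) : Prop :=
  w ∈ H10Sigma L ∧ ∀ φ ∈ H10Sigma L,
    -∫ x, gradDot w φ x ∂(vol L) = ∫ x, dot g φ x ∂(vol L)

open Classical in
/-- The operator `Δ⁻¹` on divergence-free fields. -/
def invLaplace (g : Fin 2 → Channel L → ℝ) : Fin 2 → Channel L → ℝ :=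
  if h : ∃ w, IsInvLaplace g w then h.choose else 0

/-- `-2⟨U₂ v₁⟩ - ν⟨|∇v|²⟩ - ν⁻¹⟨|∇Δ⁻¹ℙ(U·∇v)|²⟩`. -/
def dissipationFunctional (ν : ℝ) (U v : Fin 2 → Channel L → ℝ) : ℝ :=
  -2 * (⨍ x, U 1 x * v 0 x ∂(vol L)) - ν * meanGradSq v
    - ν⁻¹ * meanGradSq (invLaplace (leray (advect U v)))

end Fields

end Couette

end

/-! Write `u = x₂ e₁ + w` with `w ∈ V`, and let `a(v,φ) = ∫ ∇v:∇φ`, `b(v,φ) = ∫ (U·∇v)·φ`, `ℓ(φ) = ∫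
U₂ φ₁`. Since `U·∇(x₂ e₁) = U₂ e₁`, the steady problem reads `ν a(w,φ) + b(w,φ) = -ℓ(φ)` on `V`. The
cross term `2∂₂w₁` has mean zero, so `⟨|∇u|²⟩ = ⟨|∇w|²⟩ + 1`.

The form `b` is antisymmetric because `U` is divergence-free, so it does not affect coercivity.
Lax–Milgram, with the Poincaré inequality `H10Jet.norm_none_le`, solves the steady problem, its
adjoint (`-b` for `b`) and the Stokes problem (no `b`); see `exists_weak_solution`.

For `v ∈ V` let `t = Δ⁻¹ℙ(U·∇v)`, that is, `-a(t,φ) = b(v,φ)` on `V`; the projector disappears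
because `V ⊂ L²_σ`. Completing the square (`dual_functional_eq`) shows that the functional, up to
the factor `1/|Ω|`, is `ν a(w,w) - ν a(r,r)` with `r = v + t/ν - w`. This gives the upper bound.
Equality holds for `v = (w + w')/2`, where `w'` solves the adjoint problem
(`dual_functional_maximizer`).

To work in a Hilbert space, a function of `H¹₀` is replaced by the triple of `L²` classes of its
value and derivatives (a jet). `H¹₀` becomes the closure of the jets of test functions, so closed
relations pass from test functions to all of it. -/

namespace Couette

/-! ### Calculus of smooth functions on the channel -/

section Calculus

variable {L : ℝ}

/-- The covering map `ℝ × ℝ → 𝕋_L × ℝ`. -/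
def cover (L : ℝ) (p : ℝ × ℝ) : Channel L := ((p.1 : AddCircle L), p.2)

theorem isOpenQuotientMap_cover (L : ℝ) : IsOpenQuotientMap (cover L) :=
  (QuotientAddGroup.isOpenQuotientMap_mk (G := ℝ) (N := AddSubgroup.zmultiples L)).prodMap
    IsOpenQuotientMap.id

theorem IsSmooth.contDiff {φ : Channel L → ℝ} (h : IsSmooth φ) :
    ContDiff ℝ ∞ (φ ∘ cover L) := h

theorem IsSmooth.continuous {φ : Channel L → ℝ} (h : IsSmooth φ) : Continuous φ :=
  (isOpenQuotientMap_cover L).isQuotientMap.continuous_iff.2 h.contDiff.continuous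

theorem IsSmooth.add {φ ψ : Channel L → ℝ} (h : IsSmooth φ) (h' : IsSmooth ψ) :
    IsSmooth (φ + ψ) := ContDiff.add h h'

theorem IsSmooth.mul {φ ψ : Channel L → ℝ} (h : IsSmooth φ) (h' : IsSmooth ψ) :
    IsSmooth (φ * ψ) := ContDiff.mul h h'

theorem isSmooth_const (c : ℝ) : IsSmooth (fun _ : Channel L => c) := contDiff_const

theorem isSmooth_snd : IsSmooth (fun x : Channel L => x.2) := contDiff_snd

/-- The coordinate directions of `ℝ × ℝ`. -/
def dir (j : Fin 2) : ℝ × ℝ := if j = 0 then (1, 0) else (0, 1)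

theorem IsSmooth.hasDerivAt_fst {φ : Channel L → ℝ} (h : IsSmooth φ) (s y : ℝ) :
    HasDerivAt (fun t => φ (cover L (t, y))) (fderiv ℝ (φ ∘ cover L) (s, y) (1, 0)) s := by
  have h1 := (h.contDiff.differentiable (by simp) (s, y)).hasFDerivAt
  exact h1.comp_hasDerivAt s ((hasDerivAt_id s).prodMk (hasDerivAt_const s y))

theorem IsSmooth.hasDerivAt_snd {φ : Channel L → ℝ} (h : IsSmooth φ) (s y : ℝ) :
    HasDerivAt (fun t => φ (cover L (s, t))) (fderiv ℝ (φ ∘ cover L) (s, y) (0, 1)) y := by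
  have h1 := (h.contDiff.differentiable (by simp) (s, y)).hasFDerivAt
  exact h1.comp_hasDerivAt y ((hasDerivAt_const y s).prodMk (hasDerivAt_id y))

theorem IsSmooth.pd_cover {φ : Channel L → ℝ} (h : IsSmooth φ) (j : Fin 2) (p : ℝ × ℝ) :
    pd j φ (cover L p) = fderiv ℝ (φ ∘ cover L) p (dir j) := by
  obtain ⟨s, y⟩ := p
  fin_cases j
  -- The derivative in `pd 0` is taken at shift `0` from the base point, hence `s + 0`.
  · have h1 := h.hasDerivAt_fst (s + 0) y
    have h2 : HasDerivAt (fun t : ℝ => φ (cover L (s + t, y)))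
        (fderiv ℝ (φ ∘ cover L) (s + 0, y) (1, 0)) 0 :=
      HasDerivAt.comp_const_add (f := fun t => φ (cover L (t, y))) s 0 h1
    simpa [pd, dir, cover] using h2.deriv
  · simpa [pd, dir, cover] using (h.hasDerivAt_snd s y).deriv

theorem IsSmooth.smooth_pd {φ : Channel L → ℝ} (h : IsSmooth φ) (j : Fin 2) : IsSmooth (pd j φ) := by
  have h1 : ContDiff ℝ ∞ (fun p => fderiv ℝ (φ ∘ cover L) p (dir j)) :=
    (h.contDiff.fderiv_right (by simp)).clm_apply contDiff_const
  rwa [← (funext (h.pd_cover j) : pd j φ ∘ cover L = _)] at h1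

theorem cover_surjective (L : ℝ) : Function.Surjective (cover L) :=
  (isOpenQuotientMap_cover L).surjective

theorem pd_add {φ ψ : Channel L → ℝ} (h : IsSmooth φ) (h' : IsSmooth ψ) (j : Fin 2) :
    pd j (φ + ψ) = pd j φ + pd j ψ := by
  funext x
  obtain ⟨p, rfl⟩ := cover_surjective L x
  rw [Pi.add_apply, (h.add h').pd_cover, h.pd_cover, h'.pd_cover,
    show (φ + ψ) ∘ cover L = φ ∘ cover L + ψ ∘ cover L from rfl,
    fderiv_add (h.contDiff.differentiable (by simp) p) (h'.contDiff.differentiable (by simp) p)]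
  rfl

theorem pd_mul {φ ψ : Channel L → ℝ} (h : IsSmooth φ) (h' : IsSmooth ψ) (j : Fin 2) :
    pd j (φ * ψ) = φ * pd j ψ + pd j φ * ψ := by
  funext x
  obtain ⟨p, rfl⟩ := cover_surjective L x
  rw [Pi.add_apply, Pi.mul_apply, Pi.mul_apply, (h.mul h').pd_cover, h.pd_cover, h'.pd_cover,
    show (φ * ψ) ∘ cover L = (φ ∘ cover L) * (ψ ∘ cover L) from rfl,
    fderiv_mul (h.contDiff.differentiable (by simp) p) (h'.contDiff.differentiable (by simp) p)]
  simp [mul_comm]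

theorem pd_const (c : ℝ) (j : Fin 2) : pd j (fun _ : Channel L => c) = 0 := by
  funext x; simp [pd]

theorem pd_snd (j : Fin 2) : pd j (fun x : Channel L => x.2) = fun _ => if j = 0 then 0 else 1 := by
  funext x
  fin_cases j <;> simp [pd]

theorem pd_const_smul {φ : Channel L → ℝ} (h : IsSmooth φ) (c : ℝ) (j : Fin 2) :
    pd j (c • φ) = c • pd j φ := by
  have := pd_mul (isSmooth_const (L := L) c) h j
  rw [pd_const, zero_mul, add_zero] at this
  exact this

theorem IsTest.mul_smooth {φ ψ : Channel L → ℝ} (h : IsTest φ) (h' : IsSmooth ψ) :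
    IsTest (φ * ψ) := by
  obtain ⟨hs, a, b, ha, hb, hab⟩ := h
  exact ⟨hs.mul h', a, b, ha, hb, fun x hx => hab x (left_ne_zero_of_mul hx)⟩

theorem IsTest.const_smul {φ : Channel L → ℝ} (h : IsTest φ) (c : ℝ) : IsTest (c • φ) := by
  have := h.mul_smooth (isSmooth_const c)
  rwa [mul_comm] at this

theorem IsTest.add {φ ψ : Channel L → ℝ} (h : IsTest φ) (h' : IsTest ψ) : IsTest (φ + ψ) := by
  obtain ⟨hs, a, b, ha, hb, hab⟩ := h
  obtain ⟨hs', a', b', ha', hb', hab'⟩ := h'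
  refine ⟨hs.add hs', min a a', max b b', lt_min ha ha', max_lt hb hb', fun x hx => ?_⟩
  by_cases h0 : φ x = 0
  · have := hab' x (by simpa [h0] using hx)
    exact ⟨(min_le_right _ _).trans this.1, this.2.trans (le_max_right _ _)⟩
  · have := hab x h0
    exact ⟨(min_le_left _ _).trans this.1, this.2.trans (le_max_left _ _)⟩

theorem isTest_zero : IsTest (0 : Channel L → ℝ) :=
  ⟨isSmooth_const 0, 0, 0, by norm_num, by norm_num, fun x hx => absurd rfl hx⟩

theorem IsTest.eq_zero_of_boundary {φ : Channel L → ℝ} (h : IsTest φ) {x : Channel L}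
    (hx : x.2 ∉ Ioo (-(1 / 2) : ℝ) (1 / 2)) : φ x = 0 := by
  obtain ⟨-, a, b, ha, hb, hab⟩ := h
  by_contra h0
  exact hx ⟨ha.trans_le (hab x h0).1, (hab x h0).2.trans_lt hb⟩

end Calculus

/-! ### Integration by parts for test functions -/

section Integrals

variable {L : ℝ} [Fact (0 < L)]

instance : IsFiniteMeasure (vol L) := by unfold vol; infer_instance

theorem vol_univ : vol L univ = ENNReal.ofReal L := by
  rw [vol, ← univ_prod_univ, Measure.prod_prod]
  norm_num [AddCircle.measure_univ]

theorem vol_real_univ : (vol L).real univ = L := by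
  rw [Measure.real, vol_univ, ENNReal.toReal_ofReal (Fact.out : 0 < L).le]

theorem ae_mem_strip : ∀ᵐ x ∂(vol L), x.2 ∈ Ioo (-(1 / 2) : ℝ) (1 / 2) := by
  have : ∀ᵐ y ∂((volume : Measure ℝ).restrict (Ioo (-(1 / 2) : ℝ) (1 / 2))),
      y ∈ Ioo (-(1 / 2) : ℝ) (1 / 2) := ae_restrict_mem measurableSet_Ioo
  exact Measure.quasiMeasurePreserving_snd.ae this

theorem IsSmooth.memLp {φ : Channel L → ℝ} (h : IsSmooth φ) (p : ℝ≥0∞) : MemLp φ p (vol L) := by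
  have hc : IsCompact ((univ : Set (AddCircle L)) ×ˢ Icc (-(1 / 2) : ℝ) (1 / 2)) :=
    isCompact_univ.prod isCompact_Icc
  obtain ⟨C, hC⟩ := hc.exists_bound_of_continuousOn h.continuous.continuousOn
  refine MemLp.of_bound h.continuous.aestronglyMeasurable C ?_
  filter_upwards [ae_mem_strip] with x hx
  exact hC x ⟨mem_univ _, Ioo_subset_Icc_self hx⟩

theorem IsSmooth.integrable {φ : Channel L → ℝ} (h : IsSmooth φ) : Integrable φ (vol L) :=
  memLp_one_iff_integrable.1 (h.memLp 1)

/-- Fubini and the fundamental theorem of calculus: the boundary terms cancel by periodicity in `x₁`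
and vanish at the walls in `x₂`. -/
theorem IsTest.integral_pd {φ : Channel L → ℝ} (h : IsTest φ) (j : Fin 2) :
    ∫ x, pd j φ x ∂(vol L) = 0 := by
  have hint := (h.1.smooth_pd j).integrable
  fin_cases j
  · simp only [Fin.zero_eta] at hint ⊢
    rw [vol, integral_prod_symm _ hint]
    refine integral_eq_zero_of_ae (Eventually.of_forall fun y => ?_)
    simp only [Pi.zero_apply]
    rw [← AddCircle.intervalIntegral_preimage L 0]
    have h1 : ∀ s : ℝ, pd 0 φ ((s : AddCircle L), y) = fderiv ℝ (φ ∘ cover L) (s, y) (1, 0) :=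
      fun s => h.1.pd_cover 0 (s, y)
    have hcont : Continuous fun s : ℝ => pd 0 φ ((s : AddCircle L), y) :=
      (h.1.smooth_pd 0).contDiff.continuous.comp (by fun_prop : Continuous fun s : ℝ => (s, y))
    rw [intervalIntegral.integral_eq_sub_of_hasDerivAt
      (f := fun s => φ (cover L (s, y))) (fun s _ => by rw [h1]; exact h.1.hasDerivAt_fst s y)
      (hcont.intervalIntegrable _ _)]
    have hper : ((L : ℝ) : AddCircle L) = 0 := AddCircle.coe_period L
    simp [cover, hper]
  · simp only [Fin.mk_one] at hint ⊢
    rw [vol, integral_prod _ hint]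
    refine integral_eq_zero_of_ae (Eventually.of_forall fun x => ?_)
    obtain ⟨s, rfl⟩ := QuotientAddGroup.mk_surjective x
    simp only [Pi.zero_apply]
    rw [← integral_Ioc_eq_integral_Ioo, ← intervalIntegral.integral_of_le (by norm_num)]
    have h1 : ∀ y : ℝ, pd 1 φ ((s : AddCircle L), y) = fderiv ℝ (φ ∘ cover L) (s, y) (0, 1) :=
      fun y => h.1.pd_cover 1 (s, y)
    have hcont : Continuous fun y : ℝ => pd 1 φ ((s : AddCircle L), y) :=
      (h.1.smooth_pd 1).contDiff.continuous.comp (by fun_prop : Continuous fun y : ℝ => (s, y))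
    refine (intervalIntegral.integral_eq_sub_of_hasDerivAt
      (f := fun y => φ (cover L (s, y))) (fun y _ => by
        have := h.1.hasDerivAt_snd s y
        rwa [← h1] at this)
      (hcont.intervalIntegrable _ _)).trans ?_
    rw [h.eq_zero_of_boundary (by simp [cover]), h.eq_zero_of_boundary (by simp [cover]), sub_zero]

/-- Only one factor has to vanish at the walls. The other will be `x₂`, a constant, or a potential
that is smooth up to the walls. -/
theorem IsTest.integral_mul_pd {φ q : Channel L → ℝ} (h : IsTest φ) (hq : IsSmooth q)
    (j : Fin 2) : ∫ x, φ x * pd j q x ∂(vol L) = -∫ x, pd j φ x * q x ∂(vol L) := by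
  have h0 := (h.mul_smooth hq).integral_pd j
  rw [pd_mul h.1 hq] at h0
  have := integral_add (μ := vol L) (h.1.mul (hq.smooth_pd j)).integrable
    ((h.1.smooth_pd j).mul hq).integrable
  simp only [Pi.add_apply, Pi.mul_apply] at this h0
  linarith

theorem IsSmooth.isWeakDeriv {q : Channel L → ℝ} (hq : IsSmooth q) (j : Fin 2) :
    IsWeakDeriv j q (pd j q) := fun φ hφ => by
  have := hφ.integral_mul_pd hq j
  simp only [mul_comm (q _), mul_comm (pd j q _)]
  linarith

end Integrals

/-! ### Fundamental lemma of the calculus of variations on the channel -/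

section Density

variable {L : ℝ} [Fact (0 < L)]

theorem measurePreserving_cover : MeasurePreserving (cover L)
    ((volume : Measure (ℝ × ℝ)).restrict (Ioo 0 L ×ˢ Ioo (-(1 / 2)) (1 / 2))) (vol L) := by
  have h1 := AddCircle.measurePreserving_mk L 0
  have h2 := h1.prod (MeasurePreserving.id
    ((volume : Measure ℝ).restrict (Ioo (-(1 / 2) : ℝ) (1 / 2))))
  rw [zero_add, ← restrict_Ioo_eq_restrict_Ioc, Measure.prod_restrict] at h2
  exact h2

/-- The periodic extension of a function supported in the open fundamental rectangle. -/
noncomputable def periodize (L : ℝ) [Fact (0 < L)] (η : ℝ × ℝ → ℝ) (x : Channel L) : ℝ :=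
  η ((AddCircle.equivIco L 0 x.1 : ℝ), x.2)

theorem periodize_cover {η : ℝ × ℝ → ℝ} {k : ℤ} {s y : ℝ} (hs : s - k * L ∈ Ico 0 L) :
    periodize L η (cover L (s, y)) = η (s - k * L, y) := by
  have h1 : ((s : ℝ) : AddCircle L) = ((s - k * L : ℝ) : AddCircle L) := by
    rw [AddCircle.coe_sub, ← zsmul_eq_mul, AddCircle.coe_zsmul, AddCircle.coe_period, smul_zero,
      sub_zero]
  have h2 := AddCircle.equivIco_coe_eq (p := L) (a := 0) (x := s - k * L) (by simpa using hs)
  simp only [periodize, cover]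
  rw [h1, h2]

/-- The support stays away from the edges of the rectangle, so the translates by multiples of `L`
join smoothly. -/
theorem isTest_periodize {η : ℝ × ℝ → ℝ} (hη : ContDiff ℝ ∞ η) (hc : HasCompactSupport η)
    (hsupp : tsupport η ⊆ Ioo 0 L ×ˢ Ioo (-(1 / 2)) (1 / 2)) : IsTest (periodize L η) := by
  have hL : 0 < L := Fact.out
  have hz : ∀ s y : ℝ, s ∉ Ioo 0 L → η (s, y) = 0 := fun s y hs => by
    by_contra h0
    exact hs (hsupp (subset_tsupport η h0)).1
  refine ⟨contDiff_iff_contDiffAt.2 fun p => ?_, ?_⟩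
  · obtain ⟨s, y⟩ := p
    set k : ℤ := ⌊s / L⌋
    have hk : s - k * L ∈ Ico 0 L := by
      have h1 := Int.floor_le (s / L)
      have h2 := Int.lt_floor_add_one (s / L)
      rw [le_div_iff₀ hL] at h1
      rw [div_lt_iff₀ hL] at h2
      constructor <;> nlinarith
    have hnear : ∀ᶠ q : ℝ × ℝ in 𝓝 (s, y), q.1 - k * L ∈ Ioo (-L) L := by
      have hcont : Continuous fun q : ℝ × ℝ => q.1 - k * L := by fun_prop
      exact hcont.continuousAt.eventually_mem
        (isOpen_Ioo.mem_nhds ⟨by simp only; linarith [hk.1], hk.2⟩)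
    have hsm : ContDiff ℝ ∞ fun q : ℝ × ℝ =>
        η (q.1 - k * L, q.2) + η (q.1 - (k - 1 : ℤ) * L, q.2) := by fun_prop
    refine hsm.contDiffAt.congr_of_eventuallyEq ?_
    filter_upwards [hnear] with q hq
    change periodize L η (cover L (q.1, q.2)) = _
    rcases le_or_gt 0 (q.1 - k * L) with h0 | h0
    · rw [periodize_cover (k := k) ⟨h0, hq.2⟩, hz (q.1 - (k - 1 : ℤ) * L), add_zero]
      rintro ⟨-, h⟩
      push_cast at h
      linarith
    · rw [periodize_cover (k := k - 1), hz (q.1 - k * L), zero_add]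
      · exact fun h => h0.not_gt h.1
      · push_cast
        constructor <;> linarith [hq.1]
  · have hK : IsCompact (Prod.snd '' tsupport η) := hc.isCompact.image continuous_snd
    have hmem : ∀ x : Channel L, periodize L η x ≠ 0 → x.2 ∈ Prod.snd '' tsupport η :=
      fun x hx => ⟨_, subset_tsupport η hx, rfl⟩
    rcases (Prod.snd '' tsupport η).eq_empty_or_nonempty with he | hne
    · exact ⟨0, 0, by norm_num, by norm_num, fun x hx => by simpa [he] using hmem x hx⟩
    · obtain ⟨p, hp, hpa⟩ := hK.sInf_mem hne
      obtain ⟨q, hq, hqb⟩ := hK.sSup_mem hne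
      refine ⟨_, _, ?_, ?_, fun x hx =>
        ⟨csInf_le hK.bddBelow (hmem x hx), le_csSup hK.bddAbove (hmem x hx)⟩⟩
      · rw [← hpa]; exact (hsupp hp).2.1
      · rw [← hqb]; exact (hsupp hq).2.2

/-- Pull back to the open fundamental rectangle, where the Euclidean fundamental lemma applies; its
test functions descend to the channel by `periodize`. -/
theorem ae_eq_zero_of_integral_mul_test {g : Channel L → ℝ} (hg : MemL2 g)
    (h : ∀ φ, IsTest φ → ∫ x, g x * φ x ∂(vol L) = 0) : g =ᵐ[vol L] 0 := by
  set R : Set (ℝ × ℝ) := Ioo 0 L ×ˢ Ioo (-(1 / 2)) (1 / 2)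
  have hR : IsOpen R := isOpen_Ioo.prod isOpen_Ioo
  set μ := (volume : Measure (ℝ × ℝ)).restrict R
  have hmp : MeasurePreserving (cover L) μ (vol L) := measurePreserving_cover
  have hint : Integrable g (vol L) := hg.integrable (by norm_num)
  have hG : Integrable (g ∘ cover L) μ := hmp.integrable_comp_of_integrable hint
  have key := hR.ae_eq_zero_of_integral_contDiff_smul_eq_zero (μ := μ) (f := g ∘ cover L)
    (hG.locallyIntegrable.locallyIntegrableOn _) (fun η hη hc hsupp => by
      have ht := isTest_periodize hη hc hsupp
      rw [← h _ ht, ← hmp.map_eq, integral_map hmp.measurable.aemeasurable]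
      · refine integral_congr_ae ?_
        filter_upwards [ae_restrict_mem hR.measurableSet] with p hp
        have := periodize_cover (L := L) (η := η) (k := 0) (s := p.1) (y := p.2)
          (by simpa using ⟨hp.1.1.le, hp.1.2⟩)
        simp only [Int.cast_zero, zero_mul, sub_zero] at this
        change _ = g (cover L p) * periodize L η (cover L (p.1, p.2))
        rw [this, smul_eq_mul, mul_comm]
        rfl
      · rw [hmp.map_eq]
        exact hint.aestronglyMeasurable.mul ht.1.continuous.aestronglyMeasurable)
  have key' : ∀ᵐ p ∂μ, g (cover L p) = 0 := by
    filter_upwards [key, ae_restrict_mem hR.measurableSet] with p hp hp' using hp hp'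
  -- Carrying a null set forward through `cover` requires a measurable zero set, hence a measurable
  -- representative of `g`.
  have hm : AEStronglyMeasurable g (vol L) := hint.aestronglyMeasurable
  have h1 : ∀ᵐ p ∂μ, hm.mk g (cover L p) = 0 := by
    filter_upwards [key', hmp.quasiMeasurePreserving.ae hm.ae_eq_mk] with p hp hp'
    rw [← hp', hp]
  have h2 : ∀ᵐ x ∂(vol L), hm.mk g x = 0 := by
    have := (ae_map_iff hmp.measurable.aemeasurable
      (hm.stronglyMeasurable_mk.measurable (measurableSet_singleton 0))).2 h1
    rwa [hmp.map_eq] at this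
  exact hm.ae_eq_mk.trans h2

end Density

/-! ### Weak derivatives -/

section WeakDerivatives

variable {L : ℝ} [Fact (0 < L)]

theorem MemL2.integrable_mul {f g : Channel L → ℝ} (hf : MemL2 f) (hg : MemL2 g) :
    Integrable (fun x => f x * g x) (vol L) := MemLp.integrable_mul hf hg

theorem IsSmooth.memL2 {φ : Channel L → ℝ} (h : IsSmooth φ) : MemL2 φ := h.memLp 2

theorem IsWeakDeriv.congr {j : Fin 2} {f f' g g' : Channel L → ℝ} (h : IsWeakDeriv j f g)
    (hf : f =ᵐ[vol L] f') (hg : g =ᵐ[vol L] g') : IsWeakDeriv j f' g' := fun φ hφ => by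
  have h1 := integral_congr_ae (hf.mul (EventuallyEq.refl _ (pd j φ)))
  have h2 := integral_congr_ae (hg.mul (EventuallyEq.refl _ φ))
  simp only [Pi.mul_apply] at h1 h2
  rw [← h1, ← h2]
  exact h φ hφ

/-- Two weak derivatives have the same integrals against test functions, so the choice made in `wd`
is immaterial. -/
theorem IsWeakDeriv.wd_ae_eq {j : Fin 2} {f g : Channel L → ℝ} (h : IsWeakDeriv j f g)
    (hg : MemL2 g) : wd j f =ᵐ[vol L] g := by
  have hex : ∃ g, MemL2 g ∧ IsWeakDeriv j f g := ⟨g, hg, h⟩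
  have hwd : wd j f = hex.choose := by rw [wd, dif_pos hex]
  rw [hwd]
  obtain ⟨h1, h2⟩ := hex.choose_spec
  refine (sub_ae_eq_zero _ _).1 (ae_eq_zero_of_integral_mul_test (h1.sub hg) fun φ hφ => ?_)
  have e1 := h2 φ hφ
  have e2 := h φ hφ
  simp only [Pi.sub_apply, sub_mul]
  rw [integral_sub (h1.integrable_mul hφ.1.memL2) (hg.integrable_mul hφ.1.memL2)]
  linarith

theorem MemH1.memL2_wd {f : Channel L → ℝ} (h : MemH1 f) (j : Fin 2) : MemL2 (wd j f) := by
  rw [wd, dif_pos (h.2 j)]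
  exact (h.2 j).choose_spec.1

theorem MemH1.isWeakDeriv_wd {f : Channel L → ℝ} (h : MemH1 f) (j : Fin 2) :
    IsWeakDeriv j f (wd j f) := by
  rw [wd, dif_pos (h.2 j)]
  exact (h.2 j).choose_spec.2

theorem IsWeakDeriv.add {j : Fin 2} {f g f' g' : Channel L → ℝ} (h : IsWeakDeriv j f g)
    (h' : IsWeakDeriv j f' g') (hf : MemL2 f) (hg : MemL2 g) (hf' : MemL2 f') (hg' : MemL2 g') :
    IsWeakDeriv j (f + f') (g + g') := fun φ hφ => by
  simp only [Pi.add_apply, add_mul]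
  rw [integral_add (hf.integrable_mul (hφ.1.smooth_pd j).memL2)
      (hf'.integrable_mul (hφ.1.smooth_pd j).memL2),
    integral_add (hg.integrable_mul hφ.1.memL2) (hg'.integrable_mul hφ.1.memL2), h φ hφ, h' φ hφ]
  ring

theorem IsSmooth.memH1 {q : Channel L → ℝ} (h : IsSmooth q) : MemH1 q :=
  ⟨h.memL2, fun j => ⟨pd j q, (h.smooth_pd j).memL2, h.isWeakDeriv j⟩⟩

theorem IsSmooth.wd_ae_eq {q : Channel L → ℝ} (h : IsSmooth q) (j : Fin 2) :
    wd j q =ᵐ[vol L] pd j q := (h.isWeakDeriv j).wd_ae_eq (h.smooth_pd j).memL2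

theorem MemH1.add {f g : Channel L → ℝ} (hf : MemH1 f) (hg : MemH1 g) : MemH1 (f + g) :=
  ⟨hf.1.add hg.1, fun j => ⟨_, (hf.memL2_wd j).add (hg.memL2_wd j),
    (hf.isWeakDeriv_wd j).add (hg.isWeakDeriv_wd j) hf.1 (hf.memL2_wd j) hg.1 (hg.memL2_wd j)⟩⟩

theorem MemH1.wd_add {f g : Channel L → ℝ} (hf : MemH1 f) (hg : MemH1 g) (j : Fin 2) :
    wd j (f + g) =ᵐ[vol L] wd j f + wd j g :=
  ((hf.isWeakDeriv_wd j).add (hg.isWeakDeriv_wd j) hf.1 (hf.memL2_wd j) hg.1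
    (hg.memL2_wd j)).wd_ae_eq ((hf.memL2_wd j).add (hg.memL2_wd j))

end WeakDerivatives

/-! ### `H¹₀` as a closed subspace of a Hilbert space -/

section Jets

variable (L : ℝ) [Fact (0 < L)]

/-- Triples `(f, ∂₀ f, ∂₁ f)` in `L²(Ω)`; the index `none` stands for the value. -/
abbrev Jet : Type := PiLp 2 (fun _ : Option (Fin 2) => Lp ℝ 2 (vol L))

variable {L}

/-- `X` consists of the classes of `f` and of its weak derivatives. -/
def IsJet (X : Jet L) (f : Channel L → ℝ) : Prop :=
  (X none : Channel L → ℝ) =ᵐ[vol L] f ∧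
    ∀ j : Fin 2, (X (some j) : Channel L → ℝ) =ᵐ[vol L] wd j f

/-- The `L²(Ω)` pairing. -/
noncomputable def pairing : Lp ℝ 2 (vol L) →L[ℝ] Lp ℝ 2 (vol L) →L[ℝ] ℝ :=
  (ContinuousLinearMap.mul ℝ ℝ).lpPairing (vol L) 2 2

theorem pairing_apply (f g : Lp ℝ 2 (vol L)) : pairing f g = ∫ x, f x * g x ∂(vol L) := by
  rw [pairing, ContinuousLinearMap.lpPairing_eq_integral]
  rfl

theorem pairing_eq_integral {F G : Lp ℝ 2 (vol L)} {f g : Channel L → ℝ} (hf : F =ᵐ[vol L] f)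
    (hg : G =ᵐ[vol L] g) : pairing F G = ∫ x, f x * g x ∂(vol L) := by
  rw [pairing_apply]
  exact integral_congr_ae (hf.mul hg)

theorem pairing_comm (f g : Lp ℝ 2 (vol L)) : pairing f g = pairing g f := by
  simp only [pairing_apply, mul_comm]

theorem pairing_eq_inner (f g : Lp ℝ 2 (vol L)) : pairing f g = inner ℝ f g := by
  rw [pairing_apply, L2.inner_def]
  simp [mul_comm]

theorem pairing_self (f : Lp ℝ 2 (vol L)) : pairing f f = ‖f‖ ^ 2 := by
  rw [pairing_eq_inner, real_inner_self_eq_norm_sq]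

variable (L) in
/-- The jets of test functions. -/
def testJets : Submodule ℝ (Jet L) where
  carrier := {X | ∃ φ, IsTest φ ∧ (X none : Channel L → ℝ) =ᵐ[vol L] φ ∧
    ∀ j : Fin 2, (X (some j) : Channel L → ℝ) =ᵐ[vol L] pd j φ}
  add_mem' := by
    rintro X Y ⟨φ, hφ, h1, h2⟩ ⟨ψ, hψ, h3, h4⟩
    refine ⟨φ + ψ, hφ.add hψ, (Lp.coeFn_add _ _).trans (h1.add h3), fun j => ?_⟩
    rw [pd_add hφ.1 hψ.1]
    exact (Lp.coeFn_add _ _).trans ((h2 j).add (h4 j))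
  zero_mem' := by
    refine ⟨0, isTest_zero, Lp.coeFn_zero _ _ _, fun j => ?_⟩
    have : pd j (0 : Channel L → ℝ) = 0 := pd_const 0 j
    rw [this]
    exact Lp.coeFn_zero _ _ _
  smul_mem' := by
    rintro c X ⟨φ, hφ, h1, h2⟩
    refine ⟨c • φ, hφ.const_smul c, (Lp.coeFn_smul _ _).trans (h1.const_smul c), fun j => ?_⟩
    rw [pd_const_smul hφ.1]
    exact (Lp.coeFn_smul _ _).trans ((h2 j).const_smul c)

variable (L) in
/-- The jets of the functions in `H¹₀(Ω)`. -/
noncomputable def H10Jet : Submodule ℝ (Jet L) := (testJets L).topologicalClosure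

theorem isClosed_H10Jet : IsClosed (H10Jet L : Set (Jet L)) :=
  (testJets L).isClosed_topologicalClosure

theorem H10Jet_induction {P : Jet L → Prop} (hcl : IsClosed {X | P X})
    (h : ∀ X ∈ testJets L, P X) {X : Jet L} (hX : X ∈ H10Jet L) : P X :=
  closure_minimal (s := (testJets L : Set (Jet L))) (t := {X | P X}) h hcl hX

theorem H10Jet.pairing_pd {X : Jet L} (hX : X ∈ H10Jet L) {q : Channel L → ℝ} (hq : IsSmooth q)
    (j : Fin 2) : pairing (X none) (((hq.smooth_pd j).memLp 2).toLp _) =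
      -pairing (X (some j)) ((hq.memLp 2).toLp _) := by
  refine H10Jet_induction (P := fun X => pairing (X none) (((hq.smooth_pd j).memLp 2).toLp _) =
      -pairing (X (some j)) ((hq.memLp 2).toLp _)) (isClosed_eq (by fun_prop) (by fun_prop)) ?_ hX
  rintro X ⟨φ, hφ, h1, h2⟩
  rw [pairing_eq_integral h1 (MemLp.coeFn_toLp _), pairing_eq_integral (h2 j) (MemLp.coeFn_toLp _)]
  exact hφ.integral_mul_pd hq j

theorem H10Jet.isWeakDeriv {X : Jet L} (hX : X ∈ H10Jet L) (j : Fin 2) :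
    IsWeakDeriv j (X none) (X (some j)) := fun φ hφ => by
  have := pairing_pd hX hφ.1 j
  rwa [pairing_eq_integral (EventuallyEq.refl _ _) (MemLp.coeFn_toLp _),
    pairing_eq_integral (EventuallyEq.refl _ _) (MemLp.coeFn_toLp _)] at this

/-- Poincaré inequality: for a test function, `∫ φ² = ∫ φ² ∂₂x₂ = -∫ 2x₂ φ ∂₂φ ≤ ∫ |φ| |∂₂φ|`,
because `|2x₂| ≤ 1` in the channel. Conclude with Cauchy–Schwarz. -/
theorem H10Jet.norm_none_le {X : Jet L} (hX : X ∈ H10Jet L) : ‖X none‖ ≤ ‖X (some 1)‖ := by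
  refine H10Jet_induction (P := fun X => ‖X none‖ ≤ ‖X (some 1)‖)
    (isClosed_le (by fun_prop) (by fun_prop)) ?_ hX
  rintro X ⟨φ, hφ, h1, h2⟩
  have hy : IsSmooth (fun x : Channel L => x.2) := isSmooth_snd
  have e0 := (hφ.mul_smooth hφ.1).integral_mul_pd hy 1
  have e1 : ‖X none‖ ^ 2 = ∫ x, (φ * φ) x * pd 1 (fun x : Channel L => x.2) x ∂(vol L) := by
    rw [← pairing_self, pairing_eq_integral h1 h1, pd_snd]
    simp
  have e2 : -∫ x, pd 1 (φ * φ) x * x.2 ∂(vol L) ≤ ∫ x, |φ x| * |pd 1 φ x| ∂(vol L) := by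
    rw [← integral_neg]
    have hi : Integrable (fun x => |φ x| * |pd 1 φ x|) (vol L) := by
      simpa [abs_mul] using (hφ.1.mul (hφ.1.smooth_pd 1)).integrable.abs
    refine integral_mono_ae (((hφ.1.mul hφ.1).smooth_pd 1).mul hy).integrable.neg hi ?_
    filter_upwards [ae_mem_strip] with x hx
    have : -(pd 1 (φ * φ) x * x.2) = (φ x * pd 1 φ x) * (-2 * x.2) := by
      rw [pd_mul hφ.1 hφ.1]; simp only [Pi.add_apply, Pi.mul_apply]; ring
    change -(pd 1 (φ * φ) x * x.2) ≤ |φ x| * |pd 1 φ x|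
    rw [this, ← abs_mul]
    refine (le_abs_self _).trans ?_
    rw [abs_mul]
    refine mul_le_of_le_one_right (abs_nonneg _) (abs_le.2 ⟨?_, ?_⟩) <;> linarith [hx.1, hx.2]
  have e3 : ∫ x, |φ x| * |pd 1 φ x| ∂(vol L) ≤ ‖X none‖ * ‖X (some 1)‖ := by
    have := real_inner_le_norm |X none| |X (some 1)|
    rw [← pairing_eq_inner, pairing_eq_integral (f := fun x => |φ x|) (g := fun x => |pd 1 φ x|)
      ((Lp.coeFn_abs _).trans (h1.fun_comp abs)) ((Lp.coeFn_abs _).trans ((h2 1).fun_comp abs)),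
      norm_abs_eq_norm, norm_abs_eq_norm] at this
    exact this
  have e4 : ‖X none‖ ^ 2 ≤ ‖X none‖ * ‖X (some 1)‖ := by rw [e1, e0]; exact e2.trans e3
  rcases (norm_nonneg (X none)).eq_or_lt with h0 | h0
  · rw [← h0]; exact norm_nonneg _
  · rw [sq] at e4; exact le_of_mul_le_mul_left e4 h0

/-- The value of a jet determines its derivatives, by uniqueness of weak derivatives. -/
theorem H10Jet.isJet {X : Jet L} (hX : X ∈ H10Jet L) {f : Channel L → ℝ}
    (hf : (X none : Channel L → ℝ) =ᵐ[vol L] f) : IsJet X f :=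
  ⟨hf, fun j => (((isWeakDeriv hX j).congr hf (EventuallyEq.refl _ _)).wd_ae_eq
    (Lp.memLp _)).symm⟩

theorem H10Jet.memH1 {X : Jet L} (hX : X ∈ H10Jet L) {f : Channel L → ℝ}
    (hf : (X none : Channel L → ℝ) =ᵐ[vol L] f) : MemH1 f :=
  ⟨(memLp_congr_ae hf).1 (Lp.memLp _), fun j => ⟨X (some j), Lp.memLp _,
    (isWeakDeriv hX j).congr hf (EventuallyEq.refl _ _)⟩⟩

theorem H10Jet.memH10 {X : Jet L} (hX : X ∈ H10Jet L) {f : Channel L → ℝ}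
    (hf : (X none : Channel L → ℝ) =ᵐ[vol L] f) : MemH10 f := by
  have hj := isJet hX hf
  obtain ⟨Y, hY, hlim⟩ := mem_closure_iff_seq_limit.1
    (show X ∈ closure (testJets L : Set (Jet L)) from hX)
  choose φ hφ h1 h2 using hY
  have hcomp : ∀ o, Tendsto (fun n => Y n o) atTop (𝓝 (X o)) := fun o =>
    ((by fun_prop : Continuous fun Z : Jet L => Z o).tendsto X).comp hlim
  refine ⟨memH1 hX hf, φ, hφ, ?_, fun j => ?_⟩
  · refine ((Lp.tendsto_Lp_iff_tendsto_eLpNorm' _ _).1 (hcomp none)).congr fun n => ?_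
    exact eLpNorm_congr_ae ((h1 n).sub hj.1)
  · refine ((Lp.tendsto_Lp_iff_tendsto_eLpNorm' _ _).1 (hcomp (some j))).congr fun n => ?_
    exact eLpNorm_congr_ae ((h2 n j).sub (hj.2 j))

/-- The approximating test functions in `MemH10` converge in all three components, hence as jets. -/
theorem MemH10.exists_jet {f : Channel L → ℝ} (hf : MemH10 f) :
    ∃ X ∈ H10Jet L, IsJet X f := by
  obtain ⟨hf1, φ, hφ, h1, h2⟩ := hf
  let J : (F : Option (Fin 2) → Channel L → ℝ) → (∀ o, MemL2 (F o)) → Jet L :=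
    fun F hF => WithLp.toLp 2 fun o => (hF o).toLp (F o)
  have hfm : ∀ o : Option (Fin 2), MemL2 (o.elim f (wd · f)) := by
    rintro (_ | j)
    exacts [hf1.1, hf1.memL2_wd j]
  have hφm : ∀ n, ∀ o : Option (Fin 2), MemL2 (o.elim (φ n) (pd · (φ n))) := by
    rintro n (_ | j)
    exacts [(hφ n).1.memL2, ((hφ n).1.smooth_pd j).memL2]
  refine ⟨J _ hfm, ?_, MemLp.coeFn_toLp (hfm none), fun j => MemLp.coeFn_toLp (hfm (some j))⟩
  refine mem_closure_of_tendsto (f := fun n => J _ (hφm n)) (b := atTop) ?_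
    (Eventually.of_forall fun n => ⟨φ n, hφ n, MemLp.coeFn_toLp (hφm n none),
      fun j => MemLp.coeFn_toLp (hφm n (some j))⟩)
  refine ((PiLp.continuous_toLp 2 _).tendsto _).comp (tendsto_pi_nhds.2 ?_)
  rintro (_ | j)
  · exact (Lp.tendsto_Lp_iff_tendsto_eLpNorm'' _ _ _ (hfm none)).2 h1
  · exact (Lp.tendsto_Lp_iff_tendsto_eLpNorm'' _ _ _ (hfm (some j))).2 (h2 j)

end Jets

/-! ### The advection term -/

section Advection

variable {L : ℝ} [Fact (0 < L)]

/-- Multiplication of an `L²` function by a bounded function. -/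
noncomputable def mulBounded (U : Lp ℝ ∞ (vol L)) : Lp ℝ 2 (vol L) →L[ℝ] Lp ℝ 2 (vol L) :=
  (ContinuousLinearMap.mul ℝ ℝ).holderL (vol L) ∞ 2 2 U

theorem coeFn_mulBounded (U : Lp ℝ ∞ (vol L)) (f : Lp ℝ 2 (vol L)) :
    mulBounded U f =ᵐ[vol L] fun x => U x * f x :=
  (ContinuousLinearMap.mul ℝ ℝ).coeFn_holder U f

/-- The advection operator `U · ∇` on jets. -/
noncomputable def adv (U : Fin 2 → Lp ℝ ∞ (vol L)) : Jet L →L[ℝ] Lp ℝ 2 (vol L) :=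
  ∑ j : Fin 2, mulBounded (U j) ∘L PiLp.proj 2 (fun _ : Option (Fin 2) => Lp ℝ 2 (vol L)) (some j)

theorem adv_apply (U : Fin 2 → Lp ℝ ∞ (vol L)) (X : Jet L) :
    adv U X = ∑ j : Fin 2, mulBounded (U j) (X (some j)) := by
  simp [adv]

theorem adv_ae_eq {U : Fin 2 → Lp ℝ ∞ (vol L)} {u : Fin 2 → Channel L → ℝ}
    (hU : ∀ j, U j =ᵐ[vol L] u j) {X : Jet L} {d : Fin 2 → Channel L → ℝ}
    (hX : ∀ j, X (some j) =ᵐ[vol L] d j) :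
    adv U X =ᵐ[vol L] fun x => ∑ j, u j x * d j x := by
  rw [adv_apply]
  simp only [Fin.sum_univ_two]
  filter_upwards [Lp.coeFn_add (mulBounded (U 0) (X (some 0))) (mulBounded (U 1) (X (some 1))),
    coeFn_mulBounded (U 0) (X (some 0)), coeFn_mulBounded (U 1) (X (some 1)), hU 0, hU 1, hX 0,
    hX 1] with x h1 h2 h3 h4 h5 h6 h7
  rw [h1, Pi.add_apply, h2, h3, h4, h5, h6, h7]

/-- By density in each argument it suffices to take test functions `φ`, `ψ`. Then the sum of the two
sides is `∫ U·∇(φψ)`, which vanishes because `φψ` is again a test function. -/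
theorem adv_antisymm {U : Fin 2 → Lp ℝ ∞ (vol L)} {u : Fin 2 → Channel L → ℝ}
    (hU : ∀ j, U j =ᵐ[vol L] u j) (hdiv : WeaklyDivFree u) {X Y : Jet L} (hX : X ∈ H10Jet L)
    (hY : Y ∈ H10Jet L) : pairing (adv U X) (Y none) = -pairing (adv U Y) (X none) := by
  refine H10Jet_induction (P := fun X => pairing (adv U X) (Y none) = -pairing (adv U Y) (X none))
    (isClosed_eq (by fun_prop) (by fun_prop)) (fun X hX => ?_) hX
  refine H10Jet_induction (P := fun Y => pairing (adv U X) (Y none) = -pairing (adv U Y) (X none))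
    (isClosed_eq (by fun_prop) (by fun_prop)) (fun Y hY => ?_) hY
  obtain ⟨φ, hφ, h1, h2⟩ := hX
  obtain ⟨ψ, hψ, h3, h4⟩ := hY
  have h0 := hdiv _ (hφ.mul_smooth hψ.1)
  rw [eq_neg_iff_add_eq_zero, ← h0, pairing_apply, pairing_apply, ← integral_add
    (MemL2.integrable_mul (Lp.memLp _) (Lp.memLp _))
    (MemL2.integrable_mul (Lp.memLp _) (Lp.memLp _))]
  refine integral_congr_ae ?_
  filter_upwards [adv_ae_eq hU h2, adv_ae_eq hU h4, h1, h3] with x e1 e2 e3 e4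
  simp only [e1, e2, e3, e4, pd_mul hφ.1 hψ.1, Fin.sum_univ_two, Pi.add_apply, Pi.mul_apply]
  ring

end Advection

/-- Lax–Milgram on a complete subspace, with coercivity required only there. -/
theorem exists_mem_forall_apply_eq {H : Type*} [NormedAddCommGroup H] [InnerProductSpace ℝ H]
    (K : Submodule ℝ H) [CompleteSpace K] (B : H →L[ℝ] H →L[ℝ] ℝ) {c : ℝ} (hc : 0 < c)
    (hB : ∀ x ∈ K, c * ‖x‖ ^ 2 ≤ B x x) (ℓ : H →L[ℝ] ℝ) :
    ∃ x ∈ K, ∀ y ∈ K, B x y = ℓ y := by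
  have hco : IsCoercive (B.bilinearComp K.subtypeL K.subtypeL) :=
    ⟨c, hc, fun x => by simpa [mul_assoc, ← sq] using hB x x.2⟩
  refine ⟨hco.continuousLinearEquivOfBilin.symm
    ((InnerProductSpace.toDual ℝ K).symm (ℓ ∘L K.subtypeL)), Subtype.mem _, fun y hy => ?_⟩
  have h := hco.continuousLinearEquivOfBilin_apply (hco.continuousLinearEquivOfBilin.symm
    ((InnerProductSpace.toDual ℝ K).symm (ℓ ∘L K.subtypeL))) ⟨y, hy⟩
  rw [ContinuousLinearEquiv.apply_symm_apply, InnerProductSpace.toDual_symm_apply] at h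
  exact h.symm

/-! ### Divergence-free fields and the linear problems on them -/

section VelocityFields

variable (L : ℝ) [Fact (0 < L)]

/-- Pairs of jets. -/
abbrev JetField : Type := PiLp 2 (fun _ : Fin 2 => Jet L)

/-- The jets of the divergence-free fields in `H¹₀(Ω)`. -/
noncomputable def Vel : Submodule ℝ (JetField L) where
  carrier := {X | (∀ i, X i ∈ H10Jet L) ∧ ∑ i : Fin 2, X i (some i) = 0}
  add_mem' := by
    rintro X Y ⟨h1, h2⟩ ⟨h3, h4⟩
    refine ⟨fun i => (H10Jet L).add_mem (h1 i) (h3 i), ?_⟩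
    simp only [PiLp.add_apply, Finset.sum_add_distrib, h2, h4, add_zero]
  zero_mem' := ⟨fun i => (H10Jet L).zero_mem, by simp⟩
  smul_mem' := by
    rintro c X ⟨h1, h2⟩
    refine ⟨fun i => (H10Jet L).smul_mem c (h1 i), ?_⟩
    simp only [PiLp.smul_apply, ← Finset.smul_sum, h2, smul_zero]

variable {L}

theorem isClosed_Vel : IsClosed (Vel L : Set (JetField L)) := by
  refine IsClosed.inter (s₁ := {X : JetField L | ∀ i, X i ∈ H10Jet L}) ?_
    (isClosed_eq (by fun_prop) continuous_const)
  rw [ofPred_forall]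
  exact isClosed_iInter fun i => isClosed_H10Jet.preimage
    (by fun_prop : Continuous fun X : JetField L => X i)

instance : CompleteSpace (Vel L) := isClosed_Vel.completeSpace_coe

/-- The components of a pair of jets. -/
noncomputable def comp (i : Fin 2) (o : Option (Fin 2)) : JetField L →L[ℝ] Lp ℝ 2 (vol L) :=
  PiLp.proj 2 (fun _ : Option (Fin 2) => Lp ℝ 2 (vol L)) o ∘L PiLp.proj 2 (fun _ : Fin 2 => Jet L) i

@[simp] theorem comp_apply (i : Fin 2) (o : Option (Fin 2)) (X : JetField L) :
    comp i o X = X i o := rfl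

/-- The Dirichlet form `∫ ∇v : ∇w`. -/
noncomputable def gradForm : JetField L →L[ℝ] JetField L →L[ℝ] ℝ :=
  ∑ i : Fin 2, ∑ j : Fin 2, pairing.bilinearComp (comp i (some j)) (comp i (some j))

theorem gradForm_apply (X Y : JetField L) :
    gradForm X Y = ∑ i : Fin 2, ∑ j : Fin 2, pairing (X i (some j)) (Y i (some j)) := by
  simp [gradForm]

/-- The advection form `∫ (U·∇v) · w`. -/
noncomputable def advForm (U : Fin 2 → Lp ℝ ∞ (vol L)) : JetField L →L[ℝ] JetField L →L[ℝ] ℝ :=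
  ∑ i : Fin 2, pairing.bilinearComp (adv U ∘L PiLp.proj 2 (fun _ : Fin 2 => Jet L) i) (comp i none)

theorem advForm_apply (U : Fin 2 → Lp ℝ ∞ (vol L)) (X Y : JetField L) :
    advForm U X Y = ∑ i : Fin 2, pairing (adv U (X i)) (Y i none) := by
  simp [advForm]

/-- The linear form `∫ g · w`. -/
noncomputable def loadForm (G : Fin 2 → Lp ℝ 2 (vol L)) : JetField L →L[ℝ] ℝ :=
  ∑ i : Fin 2, pairing (G i) ∘L comp i none

theorem loadForm_apply (G : Fin 2 → Lp ℝ 2 (vol L)) (Y : JetField L) :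
    loadForm G Y = ∑ i : Fin 2, pairing (G i) (Y i none) := by
  simp [loadForm]

theorem gradForm_comm (X Y : JetField L) : gradForm X Y = gradForm Y X := by
  simp only [gradForm_apply, pairing_comm]

theorem gradForm_self_nonneg (X : JetField L) : 0 ≤ gradForm X X := by
  simp only [gradForm_apply, pairing_self]
  positivity

/-- The jet norm contains values and gradient; by Poincaré the values cost at most one more
Dirichlet form, hence the factor `2`. -/
theorem norm_sq_le_gradForm {X : JetField L} (hX : X ∈ Vel L) : ‖X‖ ^ 2 ≤ 2 * gradForm X X := by
  have h1 : ∀ i, ‖X i none‖ ^ 2 ≤ ‖X i (some 1)‖ ^ 2 := fun i =>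
    pow_le_pow_left₀ (norm_nonneg _) (H10Jet.norm_none_le (hX.1 i)) 2
  simp only [gradForm_apply, pairing_self, PiLp.norm_sq_eq_of_L2, Fintype.sum_option,
    Fin.sum_univ_two]
  nlinarith [h1 0, h1 1, sq_nonneg ‖X 0 (some 0)‖, sq_nonneg ‖X 1 (some 0)‖]

theorem advForm_antisymm {U : Fin 2 → Lp ℝ ∞ (vol L)} {u : Fin 2 → Channel L → ℝ}
    (hU : ∀ j, U j =ᵐ[vol L] u j) (hdiv : WeaklyDivFree u) {X Y : JetField L} (hX : X ∈ Vel L)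
    (hY : Y ∈ Vel L) : advForm U X Y = -advForm U Y X := by
  simp only [advForm_apply, ← Finset.sum_neg_distrib]
  exact Finset.sum_congr rfl fun i _ => adv_antisymm hU hdiv (hX.1 i) (hY.1 i)

theorem advForm_self {U : Fin 2 → Lp ℝ ∞ (vol L)} {u : Fin 2 → Channel L → ℝ}
    (hU : ∀ j, U j =ᵐ[vol L] u j) (hdiv : WeaklyDivFree u) {X : JetField L} (hX : X ∈ Vel L) :
    advForm U X X = 0 := by
  linarith [advForm_antisymm hU hdiv hX hX]

/-- The advection form vanishes on the diagonal, so the form is coercive with constant `ν / 2`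
whatever the size of `U`. The sign `σ` is `1` for the steady problem, `-1` for its adjoint and `0`
for the Stokes problem. -/
theorem exists_weak_solution {ν : ℝ} (hν : 0 < ν) (σ : ℝ) {U : Fin 2 → Lp ℝ ∞ (vol L)}
    {u : Fin 2 → Channel L → ℝ} (hU : ∀ j, U j =ᵐ[vol L] u j) (hdiv : WeaklyDivFree u)
    (ℓ : JetField L →L[ℝ] ℝ) :
    ∃ X ∈ Vel L, ∀ Y ∈ Vel L, ν * gradForm X Y + σ * advForm U X Y = ℓ Y := by
  refine exists_mem_forall_apply_eq (Vel L) (ν • gradForm + σ • advForm U)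
    (half_pos hν) (fun X hX => ?_) ℓ
  change ν / 2 * ‖X‖ ^ 2 ≤ ν * gradForm X X + σ * advForm U X X
  rw [advForm_self hU hdiv hX, mul_zero, add_zero]
  calc ν / 2 * ‖X‖ ^ 2 ≤ ν / 2 * (2 * gradForm X X) :=
        mul_le_mul_of_nonneg_left (norm_sq_le_gradForm hX) (by positivity)
    _ = ν * gradForm X X := by ring

theorem weak_solution_unique {ν : ℝ} (hν : 0 < ν) (σ : ℝ) {U : Fin 2 → Lp ℝ ∞ (vol L)}
    {u : Fin 2 → Channel L → ℝ} (hU : ∀ j, U j =ᵐ[vol L] u j) (hdiv : WeaklyDivFree u)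
    {X X' : JetField L} (hX : X ∈ Vel L) (hX' : X' ∈ Vel L)
    (h : ∀ Y ∈ Vel L, ν * gradForm X Y + σ * advForm U X Y = ν * gradForm X' Y + σ * advForm U X' Y) :
    X = X' := by
  have hD := (Vel L).sub_mem hX hX'
  have h1 := h _ hD
  have h2 : ν * gradForm (X - X') (X - X') + σ * advForm U (X - X') (X - X') = 0 := by
    simp only [map_sub (gradForm (L := L)), map_sub (advForm U), sub_apply]
    linarith
  rw [advForm_self hU hdiv hD, mul_zero, add_zero] at h2
  have h3 : gradForm (X - X') (X - X') = 0 := by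
    rcases mul_eq_zero.1 h2 with h | h
    exacts [absurd h hν.ne', h]
  have h4 := norm_sq_le_gradForm hD
  rw [h3, mul_zero] at h4
  exact sub_eq_zero.1 (norm_eq_zero.1 (pow_eq_zero_iff two_ne_zero |>.1
    (le_antisymm h4 (sq_nonneg _))))

end VelocityFields

/-! ### The abstract variational principle -/

section Duality

variable {H : Type*} [NormedAddCommGroup H] [NormedSpace ℝ H] (K : Submodule ℝ H)
  (a b : H →L[ℝ] H →L[ℝ] ℝ) (ℓ : H → ℝ)

/-- Completion of the square behind the variational principle. -/
theorem dual_functional_eq {ν : ℝ} (hν : ν ≠ 0) (ha : ∀ x y, a x y = a y x)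
    (hb : ∀ x ∈ K, ∀ y ∈ K, b x y = -b y x) {w v t : H} (hwK : w ∈ K) (hvK : v ∈ K)
    (hw : ∀ φ ∈ K, ν * a w φ + b w φ = -ℓ φ) (ht : ∀ φ ∈ K, -a t φ = b v φ) :
    -2 * ℓ v - ν * a v v - ν⁻¹ * a t t =
      ν * a w w - ν * a (v + ν⁻¹ • t - w) (v + ν⁻¹ • t - w) := by
  have h1 := hw v hvK
  have h2 := ht v hvK
  have h3 := ht w hwK
  have h4 := hb v hvK v hvK
  have h5 := hb w hwK v hvK
  -- Here `a(t,v) = -b(v,v) = 0`.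
  have h6 : a t v = 0 := by linarith
  -- From the equation for `w` tested with `v`, using `b(w,v) = -b(v,w) = a(t,w)`.
  have h7 : ℓ v = -ν * a v w - a t w := by rw [ha v w]; linarith
  simp only [map_add, map_sub, map_smul, add_apply, sub_apply, smul_apply, smul_eq_mul,
    ha w v, ha v t, ha w t]
  rw [h6, h7]
  field_simp
  ring

/-- For `v = (w + w')/2` the definition of `t` gives `ν a(v,φ) + a(t,φ) = ν a(v,φ) - b(v,φ)`.
Averaging the two equations turns this into `-ℓ(φ) - b(w,φ) = ν a(w,φ)`, so the residual in the
square is orthogonal to `K`. -/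
theorem dual_functional_maximizer {ν : ℝ} (hν : ν ≠ 0) {w w' t : H}
    (hw : ∀ φ ∈ K, ν * a w φ + b w φ = -ℓ φ) (hw' : ∀ φ ∈ K, ν * a w' φ + -1 * b w' φ = -ℓ φ)
    (ht : ∀ φ ∈ K, -a t φ = b ((2 : ℝ)⁻¹ • (w + w')) φ) {φ : H} (hφ : φ ∈ K) :
    a ((2 : ℝ)⁻¹ • (w + w') + ν⁻¹ • t - w) φ = 0 := by
  have h1 := hw φ hφ
  have h2 := hw' φ hφ
  have h3 := ht φ hφ
  simp only [map_add, map_sub, map_smul, add_apply, sub_apply, smul_apply, smul_eq_mul] at *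
  have h4 : a t φ = -(2⁻¹ * (b w φ + b w' φ)) := by linarith
  rw [h4]
  field_simp
  linarith

end Duality

/-! ### Translation between fields and jets -/

section Representation

variable {L : ℝ} [Fact (0 < L)]

/-- `X` consists of the jets of the components of `v`. -/
def IsField (X : JetField L) (v : Fin 2 → Channel L → ℝ) : Prop := ∀ i, IsJet (X i) (v i)

theorem exists_field {v : Fin 2 → Channel L → ℝ} (hv : v ∈ H10Sigma L) :
    ∃ X ∈ Vel L, IsField X v := by
  choose X hX hXv using fun i => (hv.1 i).exists_jet
  refine ⟨WithLp.toLp 2 X, ⟨hX, ?_⟩, hXv⟩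
  rw [Fin.sum_univ_two]
  refine Lp.ext ?_
  filter_upwards [Lp.coeFn_add (X 0 (some 0)) (X 1 (some 1)), Lp.coeFn_zero ℝ 2 (vol L),
    (hXv 0).2 0, (hXv 1).2 1, hv.2] with x h1 h2 h3 h4 h5
  rw [Fin.sum_univ_two] at h5
  change (X 0 (some 0) + X 1 (some 1) : Lp ℝ 2 (vol L)) x = _
  rw [h1, h2, Pi.add_apply, h3, h4, h5]
  rfl

theorem isField_of_mem {X : JetField L} (hX : X ∈ Vel L) {v : Fin 2 → Channel L → ℝ}
    (hv : ∀ i, (X i none : Channel L → ℝ) =ᵐ[vol L] v i) : IsField X v :=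
  fun i => H10Jet.isJet (hX.1 i) (hv i)

theorem mem_H10Sigma_of_mem {X : JetField L} (hX : X ∈ Vel L) {v : Fin 2 → Channel L → ℝ}
    (hv : ∀ i, (X i none : Channel L → ℝ) =ᵐ[vol L] v i) : v ∈ H10Sigma L := by
  refine ⟨fun i => H10Jet.memH10 (hX.1 i) (hv i), ?_⟩
  have hf := isField_of_mem hX hv
  have h0 := hX.2
  rw [Fin.sum_univ_two] at h0
  have h1 := Lp.coeFn_add (X 0 (some 0)) (X 1 (some 1))
  rw [h0] at h1
  filter_upwards [h1, Lp.coeFn_zero ℝ 2 (vol L), (hf 0).2 0, (hf 1).2 1] with x h1 h2 h3 h4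
  rw [Fin.sum_univ_two, ← h3, ← h4, ← Pi.add_apply, ← h1, h2]
  rfl

theorem memL2_of_ae_eq {F : Lp ℝ 2 (vol L)} {f : Channel L → ℝ} (h : F =ᵐ[vol L] f) : MemL2 f :=
  (memLp_congr_ae h).1 (Lp.memLp _)

theorem gradForm_eq_integral {X Y : JetField L} {v w : Fin 2 → Channel L → ℝ} (hX : IsField X v)
    (hY : IsField Y w) : gradForm X Y = ∫ x, gradDot v w x ∂(vol L) := by
  have hi : ∀ i j, Integrable (fun x => wd j (v i) x * wd j (w i) x) (vol L) := fun i j =>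
    (memL2_of_ae_eq ((hX i).2 j)).integrable_mul (memL2_of_ae_eq ((hY i).2 j))
  simp only [gradDot]
  rw [gradForm_apply, integral_finsetSum _ fun i _ => integrable_finsetSum _ fun j _ => hi i j]
  refine Finset.sum_congr rfl fun i _ => ?_
  rw [integral_finsetSum _ fun j _ => hi i j]
  exact Finset.sum_congr rfl fun j _ => pairing_eq_integral ((hX i).2 j) ((hY i).2 j)

theorem loadForm_eq_integral {G : Fin 2 → Lp ℝ 2 (vol L)} {g : Fin 2 → Channel L → ℝ}
    (hG : ∀ i, G i =ᵐ[vol L] g i) {Y : JetField L} {w : Fin 2 → Channel L → ℝ}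
    (hY : IsField Y w) : loadForm G Y = ∫ x, dot g w x ∂(vol L) := by
  simp only [dot]
  rw [loadForm_apply, integral_finsetSum _ fun i _ =>
    (memL2_of_ae_eq (hG i)).integrable_mul (memL2_of_ae_eq (hY i).1)]
  exact Finset.sum_congr rfl fun i _ => pairing_eq_integral (hG i) (hY i).1

theorem adv_ae_eq_advect {U : Fin 2 → Lp ℝ ∞ (vol L)} {u : Fin 2 → Channel L → ℝ}
    (hU : ∀ j, U j =ᵐ[vol L] u j) {X : JetField L} {v : Fin 2 → Channel L → ℝ}
    (hX : IsField X v) (i : Fin 2) : adv U (X i) =ᵐ[vol L] advect u v i :=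
  adv_ae_eq hU (hX i).2

theorem advForm_eq_loadForm (U : Fin 2 → Lp ℝ ∞ (vol L)) (X Y : JetField L) :
    advForm U X Y = loadForm (fun i => adv U (X i)) Y := by
  rw [advForm_apply, loadForm_apply]

theorem IsField.integral_wd {X : JetField L} (hX : X ∈ Vel L) {v : Fin 2 → Channel L → ℝ}
    (hv : IsField X v) (i j : Fin 2) : ∫ x, wd j (v i) x ∂(vol L) = 0 := by
  have h1 : IsSmooth fun _ : Channel L => (1 : ℝ) := isSmooth_const 1
  have := H10Jet.pairing_pd (hX.1 i) h1 j
  rw [pairing_eq_integral (hv i).1 (MemLp.coeFn_toLp _),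
    pairing_eq_integral ((hv i).2 j) (MemLp.coeFn_toLp _), pd_const] at this
  simpa using this

end Representation

/-! ### The inverse Stokes operator and the Leray projector -/

section StokesOperator

variable {L : ℝ} [Fact (0 < L)]

theorem isInvLaplace_iff {G : Fin 2 → Lp ℝ 2 (vol L)} {g : Fin 2 → Channel L → ℝ}
    (hG : ∀ i, G i =ᵐ[vol L] g i) {X : JetField L} (hX : X ∈ Vel L) {w : Fin 2 → Channel L → ℝ}
    (hw : IsField X w) :
    IsInvLaplace g w ↔ ∀ Y ∈ Vel L, -gradForm X Y = loadForm G Y := by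
  constructor
  · rintro ⟨-, h⟩ Y hY
    have hf := isField_of_mem hY fun i => EventuallyEq.refl _ _
    rw [gradForm_eq_integral hw hf, loadForm_eq_integral hG hf]
    exact h _ (mem_H10Sigma_of_mem hY fun i => EventuallyEq.refl _ _)
  · refine fun h => ⟨mem_H10Sigma_of_mem hX fun i => (hw i).1, fun φ hφ => ?_⟩
    obtain ⟨Y, hY, hf⟩ := exists_field hφ
    rw [← gradForm_eq_integral hw hf, ← loadForm_eq_integral hG hf]
    exact h Y hY

theorem existsUnique_isInvLaplace {g : Fin 2 → Channel L → ℝ} (hg : ∀ i, MemL2 (g i)) :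
    ∃ w, IsInvLaplace g w ∧ ∀ w', IsInvLaplace g w' → ∀ i, w' i =ᵐ[vol L] w i := by
  have hU : ∀ j : Fin 2, ((0 : Fin 2 → Lp ℝ ∞ (vol L)) j : Channel L → ℝ) =ᵐ[vol L]
      (0 : Fin 2 → Channel L → ℝ) j := fun j => Lp.coeFn_zero _ _ _
  have hdiv : WeaklyDivFree (0 : Fin 2 → Channel L → ℝ) := fun φ _ => by simp
  let G : Fin 2 → Lp ℝ 2 (vol L) := fun i => MemLp.toLp (g i) (hg i)
  have hG : ∀ i, G i =ᵐ[vol L] g i := fun i => MemLp.coeFn_toLp (hg i)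
  obtain ⟨X, hX, h⟩ := exists_weak_solution one_pos 0 hU hdiv (-loadForm G)
  have hf := isField_of_mem hX fun i => EventuallyEq.refl _ _
  have hX' : ∀ Y ∈ Vel L, -gradForm X Y = loadForm G Y := fun Y hY => by
    have := h Y hY
    rw [neg_apply] at this
    linarith
  refine ⟨_, (isInvLaplace_iff hG hX hf).2 hX', fun w' hw' i => ?_⟩
  obtain ⟨X', hX'V, hf'⟩ := exists_field hw'.1
  have h' := (isInvLaplace_iff hG hX'V hf').1 hw'
  have : X' = X := weak_solution_unique one_pos 0 hU hdiv hX'V hX fun Y hY => by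
    linarith [h' Y hY, hX' Y hY]
  exact (hf' i).1.symm.trans (by rw [this])

theorem isInvLaplace_invLaplace {g : Fin 2 → Channel L → ℝ} (hg : ∀ i, MemL2 (g i)) :
    IsInvLaplace g (invLaplace g) := by
  have h : ∃ w, IsInvLaplace g w := (existsUnique_isInvLaplace hg).imp fun _ h => h.1
  rw [invLaplace, dif_pos h]
  exact h.choose_spec

/-- Integration by parts against `∇q` leaves no wall term, since the field vanishes there, and the
remaining integral contains the divergence. -/
theorem value_mem_L2Sigma {X : JetField L} (hX : X ∈ Vel L) :
    (WithLp.toLp 2 fun i => X i none : L2Vec L) ∈ L2Sigma L := by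
  rw [L2Sigma, Submodule.mem_orthogonal]
  intro G hG
  induction hG using Submodule.span_induction with
  | mem G hG =>
    obtain ⟨q, hq, hGq⟩ := hG
    have h1 : ∀ i : Fin 2, inner ℝ (G i) (X i none) =
        -pairing (X i (some i)) ((hq.memLp 2).toLp _) := fun i => by
      rw [← H10Jet.pairing_pd (hX.1 i) hq i, pairing_comm, pairing_eq_inner]
      congr 1
      exact Lp.ext ((hGq i).trans (MemLp.coeFn_toLp _).symm)
    rw [PiLp.inner_apply]
    simp only [h1, Finset.sum_neg_distrib]
    rw [← sum_apply, ← map_sum, hX.2]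
    simp
  | zero => exact inner_zero_left _
  | add x y _ _ hx hy => rw [inner_add_left, hx, hy, add_zero]
  | smul c x _ hx => rw [inner_smul_left, hx, mul_zero]

/-- The projector is self-adjoint and fixes the fields of `V`, so it is invisible when tested
against them. -/
theorem exists_leray {F : Fin 2 → Lp ℝ 2 (vol L)} {f : Fin 2 → Channel L → ℝ}
    (hF : ∀ i, F i =ᵐ[vol L] f i) :
    ∃ G : Fin 2 → Lp ℝ 2 (vol L), (∀ i, G i =ᵐ[vol L] leray f i) ∧
      ∀ Y ∈ Vel L, loadForm G Y = loadForm F Y := by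
  have hf : ∀ i, MemLp (f i) 2 (vol L) := fun i => memL2_of_ae_eq (hF i)
  have hFf : ∀ i, (hf i).toLp (f i) = F i := fun i =>
    Lp.ext ((MemLp.coeFn_toLp (hf i)).trans (hF i).symm)
  refine ⟨fun i => ((L2Sigma L).starProjection (WithLp.toLp 2 F) : L2Vec L) i, fun i => ?_,
    fun Y hY => ?_⟩
  · rw [leray, dif_pos hf]
    simp only [hFf]
    rfl
  · have h1 := (L2Sigma L).inner_starProjection_left_eq_right (WithLp.toLp 2 F)
      (WithLp.toLp 2 fun i => Y i none : L2Vec L)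
    rw [Submodule.starProjection_eq_self_iff.2 (value_mem_L2Sigma hY), PiLp.inner_apply,
      PiLp.inner_apply] at h1
    simpa only [loadForm_apply, pairing_eq_inner] using h1

end StokesOperator

/-! ### Subtraction of the shear flow -/

section SteadyProblem

theorem isSmooth_shear {L : ℝ} (i : Fin 2) : IsSmooth (shear (L := L) i) := by
  fin_cases i
  exacts [isSmooth_snd, isSmooth_const 0]

variable {L : ℝ} [Fact (0 < L)]

theorem wd_shear (i j : Fin 2) :
    wd j (shear (L := L) i) =ᵐ[vol L] fun _ => if i = 0 ∧ j = 1 then 1 else 0 := by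
  refine ((isSmooth_shear i).wd_ae_eq j).trans (Eventually.of_forall fun x => ?_)
  fin_cases i <;> fin_cases j <;> simp [shear, pd_snd, pd_const]

theorem wd_of_sub_shear {u : Fin 2 → Channel L → ℝ} {i : Fin 2} (h : MemH1 (u i - shear i))
    (j : Fin 2) : wd j (u i) =ᵐ[vol L]
      fun x => wd j (u i - shear i) x + if i = 0 ∧ j = 1 then 1 else 0 := by
  have h1 := h.wd_add (isSmooth_shear i).memH1 j
  rw [sub_add_cancel] at h1
  filter_upwards [h1, wd_shear i j] with x e1 e2
  rw [e1, Pi.add_apply, e2]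

/-- The vector `(U₂, 0)` is `U·∇(x₂ e₁)`, the load left after subtracting the shear. -/
theorem memL2_shear_load {U : Fin 2 → Channel L → ℝ} (hU : ∀ i, MemLp (U i) ∞ (vol L))
    (i : Fin 2) : MemL2 ((![U 1, 0] : Fin 2 → Channel L → ℝ) i) := by
  fin_cases i
  · exact (hU 1).mono_exponent le_top
  · exact MemLp.zero

theorem integrable_gradDot {X Y : JetField L} {v w : Fin 2 → Channel L → ℝ} (hX : IsField X v)
    (hY : IsField Y w) : Integrable (gradDot v w) (vol L) :=
  integrable_finsetSum _ fun i _ => integrable_finsetSum _ fun j _ =>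
    (memL2_of_ae_eq ((hX i).2 j)).integrable_mul (memL2_of_ae_eq ((hY i).2 j))

theorem integrable_dot {g w : Fin 2 → Channel L → ℝ} (hg : ∀ i, MemL2 (g i))
    (hw : ∀ i, MemL2 (w i)) : Integrable (dot g w) (vol L) :=
  integrable_finsetSum _ fun i _ => (hg i).integrable_mul (hw i)

theorem integrable_wd {X : JetField L} {v : Fin 2 → Channel L → ℝ} (hX : IsField X v)
    (i j : Fin 2) : Integrable (wd j (v i)) (vol L) :=
  MemLp.integrable (q := 2) (by norm_num) (memL2_of_ae_eq ((hX i).2 j))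

/-- The shear contributes only `∫ ∂₂φ₁`, which vanishes because `φ` is zero at the walls. -/
theorem integral_gradDot_of_sub_shear {u φ : Fin 2 → Channel L → ℝ} {X Y : JetField L}
    (hX : X ∈ Vel L) (hu : IsField X (u - shear)) (hY : Y ∈ Vel L) (hφ : IsField Y φ) :
    ∫ x, gradDot u φ x ∂(vol L) = gradForm X Y := by
  have hw := fun i => wd_of_sub_shear (u := u) (H10Jet.memH1 (hX.1 i) (hu i).1)
  rw [gradForm_eq_integral hu hφ, ← add_zero (∫ x, gradDot (u - shear) φ x ∂(vol L)),
    ← hφ.integral_wd hY 0 1, ← integral_add (integrable_gradDot hu hφ) (integrable_wd hφ 0 1)]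
  refine integral_congr_ae ?_
  filter_upwards [hw 0 0, hw 0 1, hw 1 0, hw 1 1] with x h1 h2 h3 h4
  simp [gradDot, h1, h2, h3, h4]
  ring

/-- The cross term integrates to zero, and the shear has unit gradient on a domain of area `L`. -/
theorem integral_gradDot_self_of_sub_shear {u : Fin 2 → Channel L → ℝ} {X : JetField L}
    (hX : X ∈ Vel L) (hu : IsField X (u - shear)) :
    ∫ x, gradDot u u x ∂(vol L) = gradForm X X + L := by
  have hw := fun i => wd_of_sub_shear (u := u) (H10Jet.memH1 (hX.1 i) (hu i).1)
  have h1 : ∫ x, (gradDot (u - shear) (u - shear) x + (2 * wd 1 (u 0 - shear 0) x + 1)) ∂(vol L) =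
      gradForm X X + L := by
    have hi : Integrable (fun x => 2 * wd 1 (u 0 - shear 0) x) (vol L) :=
      (integrable_wd hu 0 1).const_mul 2
    have hi' : Integrable (fun x => 2 * wd 1 (u 0 - shear 0) x + 1) (vol L) :=
      hi.add (integrable_const 1)
    have h0 : ∫ x, wd 1 (u 0 - shear 0) x ∂(vol L) = 0 := hu.integral_wd hX 0 1
    rw [integral_add (integrable_gradDot hu hu) hi',
      integral_add hi (integrable_const 1), integral_const_mul, h0,
      ← gradForm_eq_integral hu hu, integral_const, vol_real_univ]
    simp
  rw [← h1]
  refine integral_congr_ae ?_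
  filter_upwards [hw 0 0, hw 0 1, hw 1 0, hw 1 1] with x h1 h2 h3 h4
  simp [gradDot, h1, h2, h3, h4]
  ring

theorem integral_advect_of_sub_shear {U : Fin 2 → Lp ℝ ∞ (vol L)} {U' : Fin 2 → Channel L → ℝ}
    (hU : ∀ j, U j =ᵐ[vol L] U' j) {G : Fin 2 → Lp ℝ 2 (vol L)}
    (hG : ∀ i, G i =ᵐ[vol L] (![U' 1, 0] : Fin 2 → Channel L → ℝ) i)
    {u φ : Fin 2 → Channel L → ℝ} {X Y : JetField L}
    (hX : X ∈ Vel L) (hu : IsField X (u - shear)) (hφ : IsField Y φ) :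
    ∫ x, dot (advect U' u) φ x ∂(vol L) = advForm U X Y + loadForm G Y := by
  have hw := fun i => wd_of_sub_shear (u := u) (H10Jet.memH1 (hX.1 i) (hu i).1)
  have ha := adv_ae_eq_advect hU hu
  rw [advForm_eq_loadForm, loadForm_eq_integral ha hφ, loadForm_eq_integral hG hφ, ← integral_add
    (integrable_dot (fun i => memL2_of_ae_eq (ha i)) fun i => memL2_of_ae_eq (hφ i).1)
    (integrable_dot (fun i => memL2_of_ae_eq (hG i)) fun i => memL2_of_ae_eq (hφ i).1)]
  refine integral_congr_ae ?_
  filter_upwards [hw 0 0, hw 0 1, hw 1 0, hw 1 1] with x h1 h2 h3 h4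
  simp [dot, advect, h1, h2, h3, h4]
  ring

theorem isSteadySolution_iff {ν : ℝ} {U : Fin 2 → Lp ℝ ∞ (vol L)} {U' : Fin 2 → Channel L → ℝ}
    (hU : ∀ j, U j =ᵐ[vol L] U' j) {G : Fin 2 → Lp ℝ 2 (vol L)}
    (hG : ∀ i, G i =ᵐ[vol L] (![U' 1, 0] : Fin 2 → Channel L → ℝ) i)
    {u : Fin 2 → Channel L → ℝ} :
    IsSteadySolution ν U' u ↔ ∃ X ∈ Vel L, IsField X (u - shear) ∧
      ∀ Y ∈ Vel L, ν * gradForm X Y + advForm U X Y = -loadForm G Y := by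
  constructor
  · intro h
    have hmem : u - shear ∈ H10Sigma L := by
      refine ⟨h.boundary, ?_⟩
      have hw := fun i => wd_of_sub_shear (u := u) (h.boundary i).1
      filter_upwards [h.div_free, hw 0 0, hw 1 1] with x h1 h2 h3
      simpa [h2, h3] using h1
    obtain ⟨X, hX, hu⟩ := exists_field hmem
    refine ⟨X, hX, hu, fun Y hY => ?_⟩
    have hφ := isField_of_mem hY fun i => EventuallyEq.refl _ _
    have := h.momentum _ (mem_H10Sigma_of_mem hY fun i => EventuallyEq.refl _ _)
    rw [integral_gradDot_of_sub_shear hX hu hY hφ,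
      integral_advect_of_sub_shear hU hG hX hu hφ] at this
    linarith
  · rintro ⟨X, hX, hu, h⟩
    have hmem := mem_H10Sigma_of_mem hX fun i => (hu i).1
    have hw := fun i => wd_of_sub_shear (u := u) (hmem.1 i).1
    refine ⟨fun i => ?_, ?_, hmem.1, fun φ hφ => ?_⟩
    · have := (hmem.1 i).1.add (isSmooth_shear i).memH1
      rwa [Pi.sub_apply, sub_add_cancel] at this
    · filter_upwards [hmem.2, hw 0 0, hw 1 1] with x h1 h2 h3
      simpa [h2, h3] using h1
    · obtain ⟨Y, hY, hf⟩ := exists_field hφ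
      rw [integral_gradDot_of_sub_shear hX hu hY hf, integral_advect_of_sub_shear hU hG hX hu hf]
      linarith [h Y hY]

theorem average_eq_inv_mul (f : Channel L → ℝ) : ⨍ x, f x ∂(vol L) = L⁻¹ * ∫ x, f x ∂(vol L) := by
  rw [MeasureTheory.average_eq, vol_real_univ, smul_eq_mul]

/-- `T` is the jet of `Δ⁻¹ℙ(U·∇v)`. This puts the functional in the form that `dual_functional_eq`
treats, with `L⁻¹` coming from the averages. -/
theorem exists_dissipationFunctional_eq (ν : ℝ) {U : Fin 2 → Lp ℝ ∞ (vol L)}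
    {U' : Fin 2 → Channel L → ℝ} (hU : ∀ j, U j =ᵐ[vol L] U' j) {G : Fin 2 → Lp ℝ 2 (vol L)}
    (hG : ∀ i, G i =ᵐ[vol L] (![U' 1, 0] : Fin 2 → Channel L → ℝ) i)
    {v : Fin 2 → Channel L → ℝ} {X : JetField L} (hv : IsField X v) :
    ∃ T ∈ Vel L, (∀ Y ∈ Vel L, -gradForm T Y = advForm U X Y) ∧
      dissipationFunctional ν U' v =
        L⁻¹ * (-2 * loadForm G X - ν * gradForm X X - ν⁻¹ * gradForm T T) := by
  obtain ⟨P, hP, hPl⟩ := exists_leray (adv_ae_eq_advect hU hv)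
  have hinv := isInvLaplace_invLaplace fun i => memL2_of_ae_eq (hP i)
  obtain ⟨T, hT, hTf⟩ := exists_field hinv.1
  refine ⟨T, hT, fun Y hY => ?_, ?_⟩
  · rw [(isInvLaplace_iff hP hT hTf).1 hinv Y hY, hPl Y hY, advForm_eq_loadForm]
  · rw [dissipationFunctional, meanGradSq, meanGradSq, average_eq_inv_mul, average_eq_inv_mul,
      average_eq_inv_mul,
      ← gradForm_eq_integral hv hv, ← gradForm_eq_integral hTf hTf, loadForm_eq_integral hG hv]
    simp [dot]
    ring

end SteadyProblem

/-! ### Well-posedness and the maximum principle for the dissipation -/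

section Variational

variable {L : ℝ} [Fact (0 < L)]

theorem existsUnique_isSteadySolution {ν : ℝ} (hν : 0 < ν) {U : Fin 2 → Channel L → ℝ}
    (hU : ∀ i, MemLp (U i) ∞ (vol L)) (hdiv : WeaklyDivFree U) :
    ∃ u, IsSteadySolution ν U u ∧
      ∀ u', IsSteadySolution ν U u' → ∀ i, u' i =ᵐ[vol L] u i := by
  have hU' : ∀ j, ((hU j).toLp (U j) : Channel L → ℝ) =ᵐ[vol L] U j := fun j =>
    MemLp.coeFn_toLp (hU j)
  have hG := fun i => MemLp.coeFn_toLp (memL2_shear_load hU i)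
  obtain ⟨X, hX, h⟩ := exists_weak_solution hν 1 hU' hdiv
    (-loadForm fun i => MemLp.toLp _ (memL2_shear_load hU i))
  simp only [one_mul, neg_apply] at h
  refine ⟨fun i => (X i none : Channel L → ℝ) + shear i, (isSteadySolution_iff hU' hG).2
    ⟨X, hX, isField_of_mem hX fun i => ?_, h⟩, fun u' hu' i => ?_⟩
  · rw [Pi.sub_apply, add_sub_cancel_right]
  · obtain ⟨X', hX', hf', h'⟩ := (isSteadySolution_iff hU' hG).1 hu'
    obtain rfl : X' = X := weak_solution_unique hν 1 hU' hdiv hX' hX fun Y hY => by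
      rw [one_mul, one_mul, h' Y hY, h Y hY]
    filter_upwards [(hf' i).1] with x hx
    rw [Pi.add_apply, hx, Pi.sub_apply, Pi.sub_apply, sub_add_cancel]

theorem isGreatest_dissipationFunctional {ν : ℝ} (hν : 0 < ν) {U : Fin 2 → Channel L → ℝ}
    (hU : ∀ i, MemLp (U i) ∞ (vol L)) (hdiv : WeaklyDivFree U) {u : Fin 2 → Channel L → ℝ}
    (hu : IsSteadySolution ν U u) :
    IsGreatest (dissipationFunctional ν U '' H10Sigma L) (ν * meanGradSq u - ν) := by
  have hL : 0 < L := Fact.out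
  have hU' : ∀ j, ((hU j).toLp (U j) : Channel L → ℝ) =ᵐ[vol L] U j := fun j =>
    MemLp.coeFn_toLp (hU j)
  have hG := fun i => MemLp.coeFn_toLp (memL2_shear_load hU i)
  obtain ⟨W, hW, hWu, hWeq⟩ := (isSteadySolution_iff hU' hG).1 hu
  have hval : ν * meanGradSq u - ν = L⁻¹ * (ν * gradForm W W) := by
    rw [meanGradSq, average_eq_inv_mul, integral_gradDot_self_of_sub_shear hW hWu]
    field_simp
    ring
  have hanti := fun X (hX : X ∈ Vel L) Y (hY : Y ∈ Vel L) => advForm_antisymm hU' hdiv hX hY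
  rw [hval]
  constructor
  -- Attainment: the maximizer is the half-sum of `W` and the solution `W'` of the adjoint problem.
  · obtain ⟨W', hW', hW'eq⟩ := exists_weak_solution hν (-1) hU' hdiv
      (-loadForm fun i => MemLp.toLp _ (memL2_shear_load hU i))
    simp only [neg_apply] at hW'eq
    have hX := (Vel L).smul_mem (2 : ℝ)⁻¹ ((Vel L).add_mem hW hW')
    obtain ⟨T, hT, hTeq, hval'⟩ := exists_dissipationFunctional_eq ν hU' hG
      (isField_of_mem hX fun i => EventuallyEq.refl _ _)
    refine ⟨_, mem_H10Sigma_of_mem hX fun i => EventuallyEq.refl _ _, ?_⟩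
    rw [hval', dual_functional_eq (Vel L) gradForm _ _ hν.ne' gradForm_comm hanti hW hX hWeq hTeq,
      dual_functional_maximizer (Vel L) gradForm _ _ hν.ne' hWeq hW'eq hTeq
        ((Vel L).sub_mem ((Vel L).add_mem hX ((Vel L).smul_mem _ hT)) hW), mul_zero, sub_zero]
  -- Upper bound: the completed square is subtracted from the claimed maximum and is nonnegative.
  · rintro _ ⟨v, hv, rfl⟩
    obtain ⟨X, hX, hXv⟩ := exists_field hv
    obtain ⟨T, hT, hTeq, hval'⟩ := exists_dissipationFunctional_eq ν hU' hG hXv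
    rw [hval', dual_functional_eq (Vel L) gradForm _ _ hν.ne' gradForm_comm hanti hW hX hWeq hTeq]
    exact mul_le_mul_of_nonneg_left (sub_le_self _ (mul_nonneg hν.le (gradForm_self_nonneg _)))
      (inv_nonneg.2 hL.le)

end Variational

end Couette

theorem mainTheorem3 (L : ℝ) [Fact (0 < L)] (ν : ℝ) (hν : 0 < ν)
    (U : Fin 2 → Couette.Channel L → ℝ)
    (hU : ∀ i, MemLp (U i) ∞ (Couette.vol L))
    (hdiv : Couette.WeaklyDivFree U) :
    -- the operator `Δ⁻¹` is well defined on `L²`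
    (∀ g : Fin 2 → Couette.Channel L → ℝ, (∀ i, Couette.MemL2 (g i)) →
      ∃ w, Couette.IsInvLaplace g w ∧
        ∀ w', Couette.IsInvLaplace g w' → ∀ i, w' i =ᵐ[Couette.vol L] w i) ∧
    -- there is exactly one weak solution
    (∃ u, Couette.IsSteadySolution ν U u ∧
      ∀ u', Couette.IsSteadySolution ν U u' → ∀ i, u' i =ᵐ[Couette.vol L] u i) ∧
    -- the variational principle
    ∀ u, Couette.IsSteadySolution ν U u →
      IsGreatest (Couette.dissipationFunctional ν U '' Couette.H10Sigma L)
        (ν * Couette.meanGradSq u - ν) :=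
  ⟨fun _ hg => Couette.existsUnique_isInvLaplace hg,
    Couette.existsUnique_isSteadySolution hν hU hdiv,
    fun _ hu => Couette.isGreatest_dissipationFunctional hν hU hdiv hu⟩
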